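/- Let $\mathcal{M}$ be a connected Riemann surface with non-empty boundary, in the following sense: $\mathcal{M}'$ is a Riemann surface without boundary, $\mathrm{Int}(\mathcal{M})\subseteq\mathcal{M}'$ is a non-empty connected open subset, $\mathcal{M}$ is its closure in $\mathcal{M}'$, and $\partial(\mathcal{M})=\mathcal{M}\setminus\mathrm{Int}(\mathcal{M})$ is its topological frontier, with $\partial(\mathcal{M})\neq\emptyset$. (No regularity of the boundary is needed; typically it is a locally finite family of pairwise disjoint closed curves, some of which may be isolated points.) Let $Y=(Y_1,Y_2,Y_3):\mathcal{M}\to\mathbb{R}^3$ be a conformal minimal immersion, that is, a continuous map which on $\mathrm{Int}(\mathcal{M})$ is a smooth conformal immersion with zero mean curvature. Let $\pi_0:\mathbb{R}^3\to\{x_3=0\}$ be the orthogonal projection, and suppose that $\pi_0\circ Y:\mathcal{M}\to\{x_3=0\}$ is proper. Let $N=(N_1,N_2,N_3):\mathrm{Int}(\mathcal{M})\to\mathbb{S}^2$ be the Gauss map (continuous unit normal) of $Y$, and assume that the $1$-form $\psi:=N_2\,dY_1-N_1\,dY_2$ is exact on $\mathcal{M}$, that is, there is a continuous function $P:\mathcal{M}\to\mathbb{R}$,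 differentiable on $\mathrm{Int}(\mathcal{M})$, with $dP=\psi$ there; write $\int_{p_0}^p\psi:=P(p)-P(p_0)$. If there are $p_0\in\mathrm{Int}(\mathcal{M})$, $\varepsilon>0$ and $C\in\mathbb{R}$ such that $$\Bigl|\int_{p_0}^p\psi+C\Bigr|\le\|\pi_0(Y(p))\|-\varepsilon\qquad\text{for all }p\in\mathcal{M},$$ where $\|\cdot\|$ is the Euclidean norm, then $\mathcal{M}$ is relative parabolic: every bounded continuous function $f:\mathcal{M}\to\mathbb{R}$ that is harmonic on $\mathrm{Int}(\mathcal{M})$ and vanishes on $\partial(\mathcal{M})$ is identically zero. -/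

import Mathlib

open scoped ContDiff Manifold

noncomputable section

namespace BorderedSurface

/-!
A Riemann surface with boundary is given by an open subset `U` (its interior) of a Riemann
surface `M` without boundary: the surface itself is `closure U`, its boundary is `frontier U`.
A boundary component may thus be an isolated point of `frontier U`.
Functions on the surface are functions on `M`, of which only the restriction to `closure U`
matters.
-/

/-- Euclidean three-space. -/
abbrev E3 : Type := EuclideanSpace ℝ (Fin 3)

/-- The orthogonal projection onto the horizontal plane `{x₃ = 0}`, which is identified with `ℝ²`. -/
def horizontalProj (x : E3) : EuclideanSpace ℝ (Fin 2) := !₂[x 0, x 1]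

/-- The partial derivative in the direction of the first coordinate `u` of `z = u + i v`. -/
def partialU (X : ℂ → E3) (z : ℂ) : E3 := fderiv ℝ X z 1

/-- The partial derivative in the direction of the second coordinate `v` of `z = u + i v`. -/
def partialV (X : ℂ → E3) (z : ℂ) : E3 := fderiv ℝ X z Complex.I

/-- `ν` is a unit normal vector at `z` of the parametrized surface `X`. -/
def IsUnitNormal (X : ℂ → E3) (z : ℂ) (ν : E3) : Prop :=
  ‖ν‖ = 1 ∧ inner ℝ ν (partialU X z) = 0 ∧ inner ℝ ν (partialV X z) = 0

/-- The mean curvature `(eG - 2fF + gE) / (2 (EG - F²))` at `z` of the parametrized surface `X`,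
with respect to the unit normal vector `ν`. -/
def meanCurvature (X : ℂ → E3) (z : ℂ) (ν : E3) : ℝ :=
  let E : ℝ := inner ℝ (partialU X z) (partialU X z)
  let F : ℝ := inner ℝ (partialU X z) (partialV X z)
  let G : ℝ := inner ℝ (partialV X z) (partialV X z)
  let e : ℝ := inner ℝ (iteratedFDeriv ℝ 2 X z ![1, 1]) ν
  let f : ℝ := inner ℝ (iteratedFDeriv ℝ 2 X z ![1, Complex.I]) ν
  let g : ℝ := inner ℝ (iteratedFDeriv ℝ 2 X z ![Complex.I, Complex.I]) ν
  (e * G - 2 * f * F + g * E) / (2 * (E * G - F ^ 2))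

variable {M : Type*} [TopologicalSpace M] [ChartedSpace ℂ M]

/-- A conformal minimal immersion of the surface `closure U` in `ℝ³`: continuous on the surface,
and, in its interior, smooth, conformal (so its differential is injective) and of zero mean
curvature. No regularity is asked for at boundary points. -/
structure IsConformalMinimalImmersion (U : Set M) (Y : M → E3) : Prop where
  continuousOn : ContinuousOn Y (closure U)
  smooth : ∀ e ∈ atlas ℂ M, ContDiffOn ℝ ∞ (Y ∘ e.symm) (e.target ∩ e.symm ⁻¹' U)
  conformal : ∀ e ∈ atlas ℂ M, ∀ p ∈ e.source ∩ U, ConformalAt (Y ∘ e.symm) (e p)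
  minimal : ∀ e ∈ atlas ℂ M, ∀ p ∈ e.source ∩ U, ∀ ν : E3,
    IsUnitNormal (Y ∘ e.symm) (e p) ν → meanCurvature (Y ∘ e.symm) (e p) ν = 0

/-- `N` is a Gauss map of `Y`: a continuous field of unit normal vectors in the interior. -/
structure IsGaussMap (U : Set M) (Y N : M → E3) : Prop where
  continuousOn : ContinuousOn N U
  unitNormal : ∀ e ∈ atlas ℂ M, ∀ p ∈ e.source ∩ U, IsUnitNormal (Y ∘ e.symm) (e p) (N p)

/-- The 1-form `ψ = N₂ dY₁ - N₁ dY₂` at the point `p`, read in the chart `e`. -/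
def psi (Y N : M → E3) (e : OpenPartialHomeomorph M ℂ) (p : M) : ℂ →L[ℝ] ℝ :=
  N p 1 • fderiv ℝ (fun z => Y (e.symm z) 0) (e p)
    - N p 0 • fderiv ℝ (fun z => Y (e.symm z) 1) (e p)

/-- `P` is a primitive on the surface of `ψ = N₂ dY₁ - N₁ dY₂`: `dP = ψ` in the interior, and
`P` is continuous up to the boundary. Then `P p - P p₀` is the integral of `ψ` from `p₀` to `p`. -/
structure IsPrimitivePsi (U : Set M) (Y N : M → E3) (P : M → ℝ) : Prop where
  continuousOn : ContinuousOn P (closure U)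
  hasFDerivAt : ∀ e ∈ atlas ℂ M, ∀ p ∈ e.source ∩ U,
    HasFDerivAt (P ∘ e.symm) (psi Y N e p) (e p)

/-- `f` is harmonic on `U`: harmonic in every holomorphic coordinate. -/
def IsHarmonicOn (f : M → ℝ) (U : Set M) : Prop :=
  ∀ e ∈ atlas ℂ M, ∀ p ∈ e.source ∩ U, InnerProductSpace.HarmonicAt (f ∘ e.symm) (e p)

/-- The surface `closure U` is relative parabolic: the only bounded continuous function on it that
is harmonic in the interior and vanishes on the boundary is zero. -/
def IsRelativeParabolic (U : Set M) : Prop :=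
  ∀ f : M → ℝ, ContinuousOn f (closure U) → (∃ B : ℝ, ∀ p ∈ closure U, |f p| ≤ B) →
    IsHarmonicOn f U → (∀ p ∈ frontier U, f p = 0) → ∀ p ∈ closure U, f p = 0

end BorderedSurface

end

/-!
Let `Φ = X_u + i X_v ∈ ℂ³` be the complex tangent vector of a conformal parametrization `X` and `n`
its unit normal. As `Φ` is isotropic and orthogonal to `n`, the cross product with `n` acts on it as
a quarter turn: `n × Φ = ±i Φ`. The last component of this identity says that the gradient of a
primitive `Q` of `ψ` is a quarter turn of the gradient of the height `Y₃`, so `Q` is a harmonic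
conjugate of `±Y₃`, and `(∇Q)² = -(∇Y₃)² = (∇Y₁)² + (∇Y₂)²` as complex numbers. Thus
`(Y₁, Y₂, Q)` is a harmonic and conformal map into Lorentz-Minkowski space (the conjugate maximal
immersion), and for such a map `log (Y₁² + Y₂² - Q²)` is superharmonic. By the growth bound and
properness, this function is defined everywhere and tends to `∞` at infinity, and the maximum
principle for `f - δ log (Y₁² + Y₂² - Q²)`, with `δ → 0`, concludes. The term `η (Y₁² + Y₂²)` makes
the function strictly subharmonic, so that only the second derivative test is needed.
-/

noncomputable section

namespace BorderedSurface

open Filter Topology InnerProductSpace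
open scoped Gradient Laplacian Matrix

theorem deriv_deriv_nonpos_of_isLocalMax {f : ℝ → ℝ} {a : ℝ} (hmax : IsLocalMax f a)
    (hf : ContinuousAt f a) : deriv (deriv f) a ≤ 0 := by
  by_contra! hpos
  have hmin : IsLocalMin f a := isLocalMin_of_deriv_deriv_pos hpos hmax.deriv_eq_zero hf
  have hconst : f =ᶠ[𝓝 a] fun _ => f a := by
    filter_upwards [hmax, hmin] with t ht ht' using le_antisymm ht ht'
  have hderiv : deriv f =ᶠ[𝓝 a] fun _ => 0 := by simpa using hconst.deriv
  simp [hderiv.deriv_eq] at hpos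

section SecondDerivative

variable {E F : Type*} [NormedAddCommGroup E] [NormedSpace ℝ E]
  [NormedAddCommGroup F] [NormedSpace ℝ F] {x : E}

theorem hasFDerivAt_fderiv {f : E → F} (hf : ContDiffAt ℝ 2 f x) :
    HasFDerivAt (fderiv ℝ f) (fderiv ℝ (fderiv ℝ f) x) x :=
  ((hf.fderiv_right (m := 1) (by norm_num)).differentiableAt one_ne_zero).hasFDerivAt

theorem eventually_hasFDerivAt {f : E → F} (hf : ContDiffAt ℝ 2 f x) :
    ∀ᶠ y in 𝓝 x, HasFDerivAt f (fderiv ℝ f y) y :=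
  (hf.eventually (by simp)).mono fun _ h => (h.differentiableAt two_ne_zero).hasFDerivAt

theorem fderiv_fderiv_nonpos_of_isLocalMax {f : E → ℝ} (hmax : IsLocalMax f x)
    (hf : ContDiffAt ℝ 2 f x) (v : E) : fderiv ℝ (fderiv ℝ f) x v v ≤ 0 := by
  set line : ℝ → E := fun t => x + t • v
  have hline (t : ℝ) : HasDerivAt line v t := by
    simpa only [one_smul] using ((hasDerivAt_id' t).smul_const v).const_add x
  have hx : line 0 = x := by simp [line]
  have htendsto : Tendsto line (𝓝 0) (𝓝 x) := hx ▸ (hline 0).continuousAt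
  have hfirst : deriv (f ∘ line) =ᶠ[𝓝 0] fun t => fderiv ℝ f (line t) v := by
    filter_upwards [htendsto.eventually (eventually_hasFDerivAt hf)] with t ht
    exact (ht.comp_hasDerivAt t (hline t)).deriv
  have hsecond : HasDerivAt (fun t => fderiv ℝ f (line t) v) (fderiv ℝ (fderiv ℝ f) x v v) 0 := by
    rw [← hx] at hf ⊢
    simpa using ((hasFDerivAt_fderiv hf).comp_hasDerivAt 0 (hline 0)).clm_apply
      (hasDerivAt_const 0 v)
  have hmax_line : IsLocalMax (f ∘ line) 0 := by
    rw [← hx] at hmax htendsto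
    exact hmax.comp_tendsto htendsto
  have hcont : ContinuousAt (f ∘ line) 0 :=
    ContinuousAt.comp (hx ▸ hf.continuousAt) (hline 0).continuousAt
  simpa [hfirst.deriv_eq, hsecond.deriv] using deriv_deriv_nonpos_of_isLocalMax hmax_line hcont

theorem laplacian_eq_fderiv_fderiv_complexPlane (f : ℂ → F) (z : ℂ) :
    Δ f z = fderiv ℝ (fderiv ℝ f) z 1 1 + fderiv ℝ (fderiv ℝ f) z Complex.I Complex.I := by
  simp [laplacian_eq_iteratedFDeriv_complexPlane, iteratedFDeriv_two_apply]

end SecondDerivative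

section Laplacian

variable {E : Type*} [NormedAddCommGroup E] [InnerProductSpace ℝ E] [FiniteDimensional ℝ E]
  {f x y t : E → ℝ} {z : E}

theorem laplacian_eq_sum_fderiv_fderiv {F : Type*} [NormedAddCommGroup F] [NormedSpace ℝ F]
    (f : E → F) (z : E) :
    Δ f z = ∑ i, fderiv ℝ (fderiv ℝ f) z (stdOrthonormalBasis ℝ E i)
      (stdOrthonormalBasis ℝ E i) := by
  simp [laplacian_eq_iteratedFDeriv_stdOrthonormalBasis, iteratedFDeriv_two_apply]

theorem laplacian_nonpos_of_isLocalMax (hmax : IsLocalMax f z) (hf : ContDiffAt ℝ 2 f z) :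
    Δ f z ≤ 0 := by
  simpa only [laplacian_eq_sum_fderiv_fderiv] using
    Finset.sum_nonpos fun i _ => fderiv_fderiv_nonpos_of_isLocalMax hmax hf _

theorem laplacian_comp {φ φ' : ℝ → ℝ} {φ'' : ℝ} (hφ : ∀ᶠ s in 𝓝 (f z), HasDerivAt φ (φ' s) s)
    (hφ' : HasDerivAt φ' φ'' (f z)) (hf : ContDiffAt ℝ 2 f z) :
    Δ (φ ∘ f) z = φ' (f z) * Δ f z + φ'' * ‖∇ f z‖ ^ 2 := by
  have hfirst : fderiv ℝ (φ ∘ f) =ᶠ[𝓝 z] φ' ∘ f • fderiv ℝ f := by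
    filter_upwards [hf.continuousAt.eventually hφ, eventually_hasFDerivAt hf] with w hw hw'
    exact (hw.comp_hasFDerivAt w hw').fderiv
  have hsecond := (hφ'.comp_hasFDerivAt z (hf.differentiableAt two_ne_zero).hasFDerivAt).smul
    (hasFDerivAt_fderiv hf)
  rw [← (stdOrthonormalBasis ℝ E).sum_sq_norm_inner_right]
  simp only [laplacian_eq_sum_fderiv_fderiv, hfirst.fderiv_eq, hsecond.fderiv, Finset.mul_sum,
    ← Finset.sum_add_distrib]
  refine Finset.sum_congr rfl fun i _ => ?_
  simp [inner_gradient_right, mul_assoc, sq]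

theorem laplacian_log (hf : ContDiffAt ℝ 2 f z) (hz : f z ≠ 0) :
    Δ (fun w => Real.log (f w)) z = (Δ f z * f z - ‖∇ f z‖ ^ 2) / f z ^ 2 := by
  have h := laplacian_comp ((eventually_ne_nhds hz).mono fun _ => Real.hasDerivAt_log)
    (hasDerivAt_inv hz) hf
  exact h.trans (by field_simp; ring)

theorem laplacian_sq_of_harmonicAt (hf : HarmonicAt f z) : Δ (f ^ 2) z = 2 * ‖∇ f z‖ ^ 2 := by
  have h := laplacian_comp (φ := fun s => s ^ 2) (φ' := fun s => 2 * s) (φ'' := 2)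
    (.of_forall fun s => by simpa using hasDerivAt_pow 2 s)
    (by simpa using (hasDerivAt_id' (f z)).const_mul 2) hf.1
  rw [hf.2.self_of_nhds, Pi.zero_apply, mul_zero, zero_add] at h
  exact h

theorem laplacian_sq_add_sq_of_harmonicAt (hx : HarmonicAt x z) (hy : HarmonicAt y z) :
    Δ (x ^ 2 + y ^ 2) z = 2 * (‖∇ x z‖ ^ 2 + ‖∇ y z‖ ^ 2) := by
  have hx_sq : ContDiffAt ℝ 2 (x ^ 2) z := hx.1.pow 2
  have hy_sq : ContDiffAt ℝ 2 (y ^ 2) z := hy.1.pow 2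
  rw [hx_sq.laplacian_add hy_sq, laplacian_sq_of_harmonicAt hx, laplacian_sq_of_harmonicAt hy,
    mul_add]

theorem laplacian_sq_add_sq_sub_sq_of_harmonicAt (hx : HarmonicAt x z) (hy : HarmonicAt y z)
    (ht : HarmonicAt t z) :
    Δ (x ^ 2 + y ^ 2 - t ^ 2) z = 2 * (‖∇ x z‖ ^ 2 + ‖∇ y z‖ ^ 2 - ‖∇ t z‖ ^ 2) := by
  have hxy : ContDiffAt ℝ 2 (x ^ 2 + y ^ 2) z := (hx.1.pow 2).add (hy.1.pow 2)
  have ht_sq : ContDiffAt ℝ 2 (t ^ 2) z := ht.1.pow 2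
  rw [hxy.laplacian_sub ht_sq, laplacian_sq_add_sq_of_harmonicAt hx hy,
    laplacian_sq_of_harmonicAt ht, ← mul_sub]

theorem gradient_sq_add_sq_sub_sq (hx : DifferentiableAt ℝ x z) (hy : DifferentiableAt ℝ y z)
    (ht : DifferentiableAt ℝ t z) :
    ∇ (x ^ 2 + y ^ 2 - t ^ 2) z = (2 : ℝ) • (x z • ∇ x z + y z • ∇ y z - t z • ∇ t z) := by
  refine HasGradientAt.gradient (hasGradientAt_iff_hasFDerivAt.mpr ?_)
  convert! ((hx.hasFDerivAt.pow 2).add (hy.hasFDerivAt.pow 2)).sub (ht.hasFDerivAt.pow 2) using 1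
  simp only [map_smul, map_add, map_sub, toDual_gradient]
  module

end Laplacian

section Lorentz

theorem lorentz_mul_le_of_sq_add_sq_eq {a b c : ℂ} (h : a ^ 2 + b ^ 2 = c ^ 2) (x y t : ℝ) :
    (x ^ 2 + y ^ 2 - t ^ 2) * (‖a‖ ^ 2 + ‖b‖ ^ 2 - ‖c‖ ^ 2) ≤ 2 * ‖x • a + y • b - t • c‖ ^ 2 := by
  set m := ‖a‖ ^ 2 + ‖b‖ ^ 2 - ‖c‖ ^ 2 with hm
  have hm_nonneg : 0 ≤ m := by
    have : ‖c ^ 2‖ ≤ ‖a ^ 2‖ + ‖b ^ 2‖ := h ▸ norm_add_le _ _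
    simp only [norm_pow] at this
    linarith
  rcases hm_nonneg.eq_or_lt with hzero | hpos
  · rw [← hzero, mul_zero]
    positivity
  -- `D` is the determinant of `(x, y, t)` and the real and imaginary parts of `(a, b, -c)`, which
  -- are spacelike, orthogonal and of the same Lorentz square `m / 2`. The identity below is the
  -- Gram determinant of these three vectors.
  set D := x * (b.re * c.im - c.re * b.im) + y * (c.re * a.im - a.re * c.im)
    + t * (a.re * b.im - b.re * a.im) with hD
  have hgram : m * (2 * ‖x • a + y • b - t • c‖ ^ 2 - (x ^ 2 + y ^ 2 - t ^ 2) * m) = 4 * D ^ 2 := by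
    have hre := congrArg Complex.re h
    have him := congrArg Complex.im h
    simp only [sq, Complex.add_re, Complex.add_im, Complex.mul_re, Complex.mul_im] at hre him
    simp only [hm, hD, Complex.sq_norm, Complex.normSq_apply, Complex.add_re, Complex.add_im,
      Complex.sub_re, Complex.sub_im, Complex.smul_re, Complex.smul_im, smul_eq_mul]
    linear_combination
      (2 * ((x * a.re + y * b.re - t * c.re) ^ 2 - (x * a.im + y * b.im - t * c.im) ^ 2)
        - (x ^ 2 + y ^ 2 - t ^ 2)
          * (a.re ^ 2 - a.im ^ 2 + (b.re ^ 2 - b.im ^ 2) - (c.re ^ 2 - c.im ^ 2))) * hre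
      + (4 * (x * a.re + y * b.re - t * c.re) * (x * a.im + y * b.im - t * c.im)
        - 2 * (x ^ 2 + y ^ 2 - t ^ 2) * (a.re * a.im + b.re * b.im - c.re * c.im)) * him
  have := nonneg_of_mul_nonneg_right (hgram ▸ (by positivity : 0 ≤ 4 * D ^ 2)) hpos
  linarith

variable {g x y t : ℂ → ℝ} {z : ℂ}

theorem laplacian_log_sq_add_sq_sub_sq_nonpos (hx : HarmonicAt x z) (hy : HarmonicAt y z)
    (ht : HarmonicAt t z) (hnull : ∇ x z ^ 2 + ∇ y z ^ 2 = ∇ t z ^ 2)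
    (hpos : 0 < x z ^ 2 + y z ^ 2 - t z ^ 2) :
    Δ (fun w => Real.log (x w ^ 2 + y w ^ 2 - t w ^ 2)) z ≤ 0 := by
  have hcontDiff : ContDiffAt ℝ 2 (x ^ 2 + y ^ 2 - t ^ 2) z :=
    ((hx.1.pow 2).add (hy.1.pow 2)).sub (ht.1.pow 2)
  have hle := lorentz_mul_le_of_sq_add_sq_eq hnull (x z) (y z) (t z)
  refine (laplacian_log hcontDiff hpos.ne').trans_le
    (div_nonpos_of_nonpos_of_nonneg ?_ (sq_nonneg _))
  rw [laplacian_sq_add_sq_sub_sq_of_harmonicAt hx hy ht,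
    gradient_sq_add_sq_sub_sq (hx.1.differentiableAt two_ne_zero)
      (hy.1.differentiableAt two_ne_zero) (ht.1.differentiableAt two_ne_zero), norm_smul]
  simp only [mul_pow, Pi.sub_apply, Pi.add_apply, Pi.pow_apply, Real.norm_ofNat]
  linarith

theorem not_isLocalMax_sub_log_add (hg : HarmonicAt g z) (hx : HarmonicAt x z)
    (hy : HarmonicAt y z) (ht : HarmonicAt t z) (hnull : ∇ x z ^ 2 + ∇ y z ^ 2 = ∇ t z ^ 2)
    (hne : ∇ x z ≠ 0 ∨ ∇ y z ≠ 0) (hpos : 0 < x z ^ 2 + y z ^ 2 - t z ^ 2)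
    {δ η : ℝ} (hδ : 0 ≤ δ) (hη : 0 < η) :
    ¬ IsLocalMax (fun w => g w - δ * Real.log (x w ^ 2 + y w ^ 2 - t w ^ 2)
      + η * (x w ^ 2 + y w ^ 2)) z := by
  intro hmax
  set l : ℂ → ℝ := fun w => Real.log (x w ^ 2 + y w ^ 2 - t w ^ 2)
  have hl : ContDiffAt ℝ 2 l z :=
    (((hx.1.pow 2).add (hy.1.pow 2)).sub (ht.1.pow 2)).log hpos.ne'
  have hδ_l : ContDiffAt ℝ 2 (δ • l) z := hl.const_smul δ
  have hgl : ContDiffAt ℝ 2 (g - δ • l) z := hg.1.sub hδ_l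
  have hxy : ContDiffAt ℝ 2 (x ^ 2 + y ^ 2) z := (hx.1.pow 2).add (hy.1.pow 2)
  have hη_xy : ContDiffAt ℝ 2 (η • (x ^ 2 + y ^ 2)) z := hxy.const_smul η
  have hlap := laplacian_nonpos_of_isLocalMax (f := g - δ • l + η • (x ^ 2 + y ^ 2)) hmax
    (hgl.add hη_xy)
  rw [hgl.laplacian_add hη_xy, hg.1.laplacian_sub hδ_l, laplacian_smul δ hl,
    laplacian_smul η hxy, hg.2.self_of_nhds,
    laplacian_sq_add_sq_of_harmonicAt hx hy] at hlap
  have hlog : δ * Δ l z ≤ 0 := mul_nonpos_of_nonneg_of_nonpos hδ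
    (laplacian_log_sq_add_sq_sub_sq_nonpos hx hy ht hnull hpos)
  have hgrad : 0 < ‖∇ x z‖ ^ 2 + ‖∇ y z‖ ^ 2 := by
    rcases hne with h | h <;> have := norm_pos_iff.mpr h <;> positivity
  have := mul_pos hη (mul_pos two_pos hgrad)
  simp only [Pi.zero_apply, smul_eq_mul] at hlap
  linarith

end Lorentz

section Isotropic

variable {K : Type*} [Field K] {n Φ H : Fin 3 → K} {κ : K}

theorem exists_cross_eq_smul_of_isotropic (hΦ₀ : Φ ≠ 0) (hΦ : Φ ⬝ᵥ Φ = 0) (hn : n ⬝ᵥ n = 1)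
    (hnΦ : n ⬝ᵥ Φ = 0) : ∃ κ : K, κ ^ 2 = -1 ∧ n ⨯₃ Φ = κ • Φ := by
  have hparallel : Φ ⨯₃ (n ⨯₃ Φ) = 0 := by
    rw [cross_cross_eq_smul_sub_smul', hΦ, hnΦ, zero_smul, zero_smul, sub_zero]
  obtain ⟨κ, hκ⟩ : ∃ κ : K, κ • Φ = n ⨯₃ Φ := by
    by_contra! hne
    exact crossProduct_ne_zero_iff_linearIndependent.mpr
      ((LinearIndependent.pair_iff' hΦ₀).mpr hne) hparallel
  refine ⟨κ, smul_left_injective K hΦ₀ ?_, hκ.symm⟩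
  calc κ ^ 2 • Φ = n ⨯₃ (n ⨯₃ Φ) := by rw [← hκ, map_smul, ← hκ, smul_smul, sq]
    _ = (-1 : K) • Φ := by
      rw [cross_cross_eq_smul_sub_smul', hnΦ, hn, zero_smul, zero_sub, neg_smul]

theorem dotProduct_self_eq_zero_of_cross_eq_smul (hΦ₀ : Φ ≠ 0) (hκ : κ ≠ 0)
    (hcross : n ⨯₃ Φ = κ • Φ) (hHn : H ⬝ᵥ n = 0) (hHΦ : H ⬝ᵥ Φ = 0) : H ⬝ᵥ H = 0 := by
  have hparallel : H ⨯₃ Φ = 0 := by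
    have h := cross_cross_eq_smul_sub_smul' H n Φ
    rw [hcross, map_smul, hHΦ, dotProduct_comm, hHn, zero_smul, zero_smul, sub_zero] at h
    exact (smul_eq_zero_iff_right hκ).mp h
  have h := cross_cross_eq_smul_sub_smul' H H Φ
  rw [hparallel, map_zero, hHΦ, zero_smul, zero_sub, zero_eq_neg] at h
  exact (smul_eq_zero_iff_left hΦ₀).mp h

theorem continuous_crossProduct {R : Type*} [CommRing R] [TopologicalSpace R]
    [IsTopologicalRing R] :
    Continuous fun p : (Fin 3 → R) × (Fin 3 → R) => p.1 ⨯₃ p.2 := by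
  simp only [cross_apply]
  fun_prop

theorem ne_zero_of_sq_eq_neg_one (hκ : κ ^ 2 = -1) : κ ≠ 0 := by
  rintro rfl
  simp at hκ

theorem exists_eventually_cross_eq_smul {T : Type*} [TopologicalSpace T] {z : T}
    {n Φ : T → Fin 3 → ℂ} (hn : ContinuousAt n z) (hΦ : ContinuousAt Φ z) (hΦ₀ : Φ z ≠ 0)
    (h : ∀ᶠ w in 𝓝 z, ∃ κ : ℂ, κ ^ 2 = -1 ∧ n w ⨯₃ Φ w = κ • Φ w) :
    ∃ κ : ℂ, κ ^ 2 = -1 ∧ ∀ᶠ w in 𝓝 z, n w ⨯₃ Φ w = κ • Φ w := by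
  -- Near `z` the factor is `κ` or `-κ`, and `-κ` is excluded by continuity.
  obtain ⟨κ, hκ, hz⟩ := h.self_of_nhds
  have hcont : ContinuousAt (fun w => n w ⨯₃ Φ w + κ • Φ w) z :=
    (continuous_crossProduct.continuousAt.comp (hn.prodMk hΦ)).add (hΦ.const_smul κ)
  have hne : n z ⨯₃ Φ z + κ • Φ z ≠ 0 := by
    rw [hz, ← two_smul ℂ]
    exact smul_ne_zero two_ne_zero (smul_ne_zero (ne_zero_of_sq_eq_neg_one hκ) hΦ₀)
  refine ⟨κ, hκ, ?_⟩
  filter_upwards [h, hcont.eventually_ne hne] with w ⟨κ', hκ', hw⟩ hw_ne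
  rcases sq_eq_sq_iff_eq_or_eq_neg.mp (hκ'.trans hκ.symm) with rfl | rfl
  · exact hw
  · rw [hw, neg_smul, neg_add_cancel] at hw_ne
    exact absurd rfl hw_ne

end Isotropic

/-- The inclusion `ℝ³ ⊆ ℂ³`, which turns the scalar product into the bilinear product `⬝ᵥ`. -/
def complexify : E3 →L[ℝ] (Fin 3 → ℂ) :=
  .pi fun k => Complex.ofRealCLM ∘L EuclideanSpace.proj k

/-- The complex tangent vector `X_u + i X_v` of the parametrized surface `X`, whose components are
the gradients of the coordinates of `X`. It is isotropic for `⬝ᵥ` where `X` is conformal. -/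
def complexTangent (X : ℂ → E3) (z : ℂ) : Fin 3 → ℂ :=
  complexify (partialU X z) + Complex.I • complexify (partialV X z)

section Conformal

variable {X : ℂ → E3} {z : ℂ} {ν : E3}

theorem complexify_dotProduct (x y : E3) : complexify x ⬝ᵥ complexify y = (inner ℝ x y : ℝ) := by
  simp [complexify, dotProduct, PiLp.inner_apply, mul_comm]

theorem partialU_ne_zero (h : ConformalAt X z) : partialU X z ≠ 0 := by
  obtain ⟨c, hc, h⟩ := conformalAt_iff'.mp h
  rw [← inner_self_ne_zero (𝕜 := ℝ), partialU, h]
  simp [hc.ne']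

theorem norm_partialV_eq_norm_partialU (h : ConformalAt X z) :
    ‖partialV X z‖ = ‖partialU X z‖ := by
  obtain ⟨c, -, h⟩ := conformalAt_iff'.mp h
  rw [← sq_eq_sq₀ (norm_nonneg _) (norm_nonneg _), ← real_inner_self_eq_norm_sq,
    ← real_inner_self_eq_norm_sq, partialU, partialV, h, h]
  simp

theorem inner_partialU_partialV_eq_zero (h : ConformalAt X z) :
    inner ℝ (partialU X z) (partialV X z) = 0 := by
  obtain ⟨c, -, h⟩ := conformalAt_iff'.mp h
  rw [partialU, partialV, h]
  simp

theorem complexTangent_dotProduct_self (h : ConformalAt X z) :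
    complexTangent X z ⬝ᵥ complexTangent X z = 0 := by
  simp [complexTangent, complexify_dotProduct, real_inner_comm (partialU X z),
    norm_partialV_eq_norm_partialU h, inner_partialU_partialV_eq_zero h, ← mul_assoc]

theorem complexTangent_ne_zero (h : ConformalAt X z) : complexTangent X z ≠ 0 := by
  intro hzero
  have hnorm : complexify (partialU X z) ⬝ᵥ complexTangent X z = (‖partialU X z‖ : ℂ) ^ 2 := by
    simp [complexTangent, complexify_dotProduct, inner_partialU_partialV_eq_zero h]
  rw [hzero, dotProduct_zero] at hnorm
  exact partialU_ne_zero h (by simpa using hnorm.symm)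

theorem complexify_dotProduct_complexTangent (hν : IsUnitNormal X z ν) :
    complexify ν ⬝ᵥ complexTangent X z = 0 := by
  simp [complexTangent, complexify_dotProduct, hν.2.1, hν.2.2]

theorem exists_cross_complexTangent_eq_smul (h : ConformalAt X z) (hν : IsUnitNormal X z ν) :
    ∃ κ : ℂ, κ ^ 2 = -1 ∧ complexify ν ⨯₃ complexTangent X z = κ • complexTangent X z :=
  exists_cross_eq_smul_of_isotropic (complexTangent_ne_zero h) (complexTangent_dotProduct_self h)
    (by simp [complexify_dotProduct, hν.1]) (complexify_dotProduct_complexTangent hν)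

theorem hasGradientAt_coord (h : DifferentiableAt ℝ X z) (k : Fin 3) :
    HasGradientAt (fun w => X w k) (complexTangent X z k) z := by
  rw [hasGradientAt_iff_hasFDerivAt]
  refine ((EuclideanSpace.proj k).hasFDerivAt.comp z h.hasFDerivAt).congr_fderiv ?_
  ext v
  have hv : fderiv ℝ X z v = v.re • fderiv ℝ X z 1 + v.im • fderiv ℝ X z Complex.I := by
    rw [← map_smul, ← map_smul, ← map_add]
    congr 1
    simp
  simp [complexTangent, complexify, partialU, partialV, Complex.inner, hv]

theorem sum_gradient_sq_eq_zero (hX : DifferentiableAt ℝ X z) (h : ConformalAt X z) :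
    ∇ (fun w => X w 0) z ^ 2 + ∇ (fun w => X w 1) z ^ 2 + ∇ (fun w => X w 2) z ^ 2 = 0 := by
  simpa only [(hasGradientAt_coord hX _).gradient, dotProduct, Fin.sum_univ_three, sq] using
    complexTangent_dotProduct_self h

theorem gradient_horizontal_ne_zero (hX : DifferentiableAt ℝ X z) (h : ConformalAt X z) :
    ∇ (fun w => X w 0) z ≠ 0 ∨ ∇ (fun w => X w 1) z ≠ 0 := by
  by_contra! hzero
  have hsum := sum_gradient_sq_eq_zero hX h
  rw [hzero.1, hzero.2, sq, zero_mul, zero_add, zero_add, sq_eq_zero_iff] at hsum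
  refine complexTangent_ne_zero h (funext fun k => ?_)
  rw [← (hasGradientAt_coord hX k).gradient]
  fin_cases k
  exacts [hzero.1, hzero.2, hsum]

theorem hasFDerivAt_complexTangent (hX : ContDiffAt ℝ 2 X z) :
    HasFDerivAt (complexTangent X)
      (complexify ∘L (fderiv ℝ (fderiv ℝ X) z).flip 1
        + Complex.I • complexify ∘L (fderiv ℝ (fderiv ℝ X) z).flip Complex.I) z := by
  have hpartial (v : ℂ) : HasFDerivAt (fun w => complexify (fderiv ℝ X w v))
      (complexify ∘L (fderiv ℝ (fderiv ℝ X) z).flip v) z := by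
    simpa using complexify.hasFDerivAt.comp z
      ((hasFDerivAt_fderiv hX).clm_apply (hasFDerivAt_const v z))
  exact (hpartial 1).add ((hpartial Complex.I).const_smul Complex.I)

theorem fderiv_complexTangent_dotProduct (hX : ContDiffAt ℝ 2 X z)
    (hconf : ∀ᶠ w in 𝓝 z, ConformalAt X w) (v : ℂ) :
    fderiv ℝ (complexTangent X) z v ⬝ᵥ complexTangent X z = 0 := by
  have hΦ := hasFDerivAt_pi'.mp (hasFDerivAt_complexTangent hX).differentiableAt.hasFDerivAt
  have hsq := HasFDerivAt.fun_sum (u := Finset.univ) fun k _ => (hΦ k).mul (hΦ k)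
  have hzero : (fun w => ∑ k, complexTangent X w k * complexTangent X w k) =ᶠ[𝓝 z] fun _ => 0 :=
    hconf.mono fun w hw => complexTangent_dotProduct_self hw
  have h := congrArg (· v) (hsq.unique ((hasFDerivAt_const 0 z).congr_of_eventuallyEq hzero))
  have htwice : 2 * (fderiv ℝ (complexTangent X) z v ⬝ᵥ complexTangent X z) = 0 := by
    simpa [dotProduct, Finset.sum_add_distrib, two_mul, mul_comm] using h
  exact (mul_eq_zero_iff_left two_ne_zero).mp htwice

theorem complexify_laplacian (hX : ContDiffAt ℝ 2 X z) :
    complexify (Δ X z) = fderiv ℝ (complexTangent X) z 1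
      - Complex.I • fderiv ℝ (complexTangent X) z Complex.I := by
  have hsymm := (hX.isSymmSndFDerivAt (by simp)).eq 1 Complex.I
  rw [(hasFDerivAt_complexTangent hX).fderiv, laplacian_eq_fderiv_fderiv_complexPlane]
  simp only [add_apply, smul_apply, ContinuousLinearMap.comp_apply,
    ContinuousLinearMap.flip_apply, hsymm, smul_add, smul_smul, Complex.I_mul_I, neg_smul,
    one_smul, map_add]
  abel

theorem inner_laplacian_eq_zero_of_meanCurvature_eq_zero (hconf : ConformalAt X z)
    (hmin : meanCurvature X z ν = 0) : inner ℝ (Δ X z) ν = 0 := by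
  have hU : ‖partialU X z‖ ≠ 0 := norm_ne_zero_iff.mpr (partialU_ne_zero hconf)
  simp only [meanCurvature, real_inner_self_eq_norm_sq, norm_partialV_eq_norm_partialU hconf,
    inner_partialU_partialV_eq_zero hconf] at hmin
  rw [laplacian_eq_iteratedFDeriv_complexPlane, inner_add_left]
  field_simp at hmin
  refine mul_left_cancel₀ (pow_ne_zero 2 hU) ?_
  linear_combination hmin

theorem laplacian_eq_zero_of_meanCurvature_eq_zero (hX : ContDiffAt ℝ 2 X z)
    (hconf : ∀ᶠ w in 𝓝 z, ConformalAt X w) (hν : IsUnitNormal X z ν)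
    (hmin : meanCurvature X z ν = 0) : Δ X z = 0 := by
  have hconf_z := hconf.self_of_nhds
  obtain ⟨κ, hκ, hcross⟩ := exists_cross_complexTangent_eq_smul hconf_z hν
  have hnormal : complexify (Δ X z) ⬝ᵥ complexify ν = 0 := by
    rw [complexify_dotProduct, inner_laplacian_eq_zero_of_meanCurvature_eq_zero hconf_z hmin,
      Complex.ofReal_zero]
  have htangent : complexify (Δ X z) ⬝ᵥ complexTangent X z = 0 := by
    rw [complexify_laplacian hX, sub_dotProduct, smul_dotProduct,
      fderiv_complexTangent_dotProduct hX hconf, fderiv_complexTangent_dotProduct hX hconf,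
      smul_zero, sub_zero]
  have h := dotProduct_self_eq_zero_of_cross_eq_smul (complexTangent_ne_zero hconf_z)
    (ne_zero_of_sq_eq_neg_one hκ) hcross hnormal htangent
  simpa [complexify_dotProduct] using h

theorem harmonicAt_of_meanCurvature_eq_zero {ν : ℂ → E3} (hX : ContDiffAt ℝ 2 X z)
    (hconf : ∀ᶠ w in 𝓝 z, ConformalAt X w) (hν : ∀ᶠ w in 𝓝 z, IsUnitNormal X w (ν w))
    (hmin : ∀ᶠ w in 𝓝 z, meanCurvature X w (ν w) = 0) : HarmonicAt X z := by
  refine ⟨hX, ?_⟩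
  filter_upwards [hX.eventually (by simp), hconf.eventually_nhds, hν, hmin]
    with w hXw hconf_w hνw hmin_w
  exact laplacian_eq_zero_of_meanCurvature_eq_zero hXw hconf_w hνw hmin_w

end Conformal

section Conjugate

variable {h p : ℂ → ℝ} {κ z : ℂ}

theorem hasFDerivAt_of_hasGradientAt_mul (hp : HasGradientAt p (κ * ∇ h z) z) :
    HasFDerivAt p ((fderiv ℝ h z).comp (.mul ℝ ℂ (starRingEnd ℂ κ))) z := by
  refine (hasGradientAt_iff_hasFDerivAt.mp hp).congr_fderiv (ContinuousLinearMap.ext fun v => ?_)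
  calc inner ℝ (κ * ∇ h z) v = inner ℝ (∇ h z) (starRingEnd ℂ κ * v) := by
        simp only [Complex.inner, map_mul]
        ring_nf
    _ = fderiv ℝ h z (starRingEnd ℂ κ * v) := inner_gradient_left

theorem laplacian_eq_zero_of_hasGradientAt_mul (hh : ContDiffAt ℝ 2 h z) (hκ : κ ^ 2 = -1)
    (hp : ∀ᶠ w in 𝓝 z, HasGradientAt p (κ * ∇ h w) w) : Δ p z = 0 := by
  let rot : ℂ →L[ℝ] ℂ := .mul ℝ ℂ (starRingEnd ℂ κ)
  let precompRot := (ContinuousLinearMap.compL ℝ ℂ ℂ ℝ).flip rot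
  have hfirst : fderiv ℝ p =ᶠ[𝓝 z] precompRot ∘ fderiv ℝ h :=
    hp.mono fun w hw => (hasFDerivAt_of_hasGradientAt_mul hw).fderiv
  have hsecond := precompRot.hasFDerivAt.comp z (hasFDerivAt_fderiv hh)
  have hsymm := (hh.isSymmSndFDerivAt (by simp)).eq 1 Complex.I
  have hκ_cases : κ = Complex.I ∨ κ = -Complex.I := by
    rw [← sq_eq_sq_iff_eq_or_eq_neg, hκ, Complex.I_sq]
  rw [laplacian_eq_fderiv_fderiv_complexPlane, hfirst.fderiv_eq, hsecond.fderiv]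
  rcases hκ_cases with rfl | rfl <;> simp [precompRot, rot, hsymm]

theorem harmonicAt_of_hasGradientAt_mul (hh : ContDiffAt ℝ 2 h z) (hκ : κ ^ 2 = -1)
    (hp : ∀ᶠ w in 𝓝 z, HasGradientAt p (κ * ∇ h w) w) : HarmonicAt p z := by
  refine ⟨(contDiffAt_succ_iff_hasFDerivAt (n := 1)).mpr
    ⟨_, ⟨_, hp, fun _ => hasFDerivAt_of_hasGradientAt_mul⟩,
      (hh.fderiv_right (m := 1) (by norm_num)).clm_comp contDiffAt_const⟩, ?_⟩
  filter_upwards [hh.eventually (by simp), hp.eventually_nhds] with w hw hpw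
  exact laplacian_eq_zero_of_hasGradientAt_mul hw hκ hpw

end Conjugate

section Minimal

variable {X ν : ℂ → E3} {g p : ℂ → ℝ} {z : ℂ}

theorem exists_hasGradientAt_mul (hX : ContDiffAt ℝ 2 X z)
    (hconf : ∀ᶠ w in 𝓝 z, ConformalAt X w) (hν : ∀ᶠ w in 𝓝 z, IsUnitNormal X w (ν w))
    (hν_cont : ContinuousAt ν z)
    (hp : ∀ᶠ w in 𝓝 z, HasFDerivAt p (ν w 1 • fderiv ℝ (fun y => X y 0) w
      - ν w 0 • fderiv ℝ (fun y => X y 1) w) w) :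
    ∃ κ : ℂ, κ ^ 2 = -1 ∧ ∀ᶠ w in 𝓝 z, HasGradientAt p (κ * ∇ (fun y => X y 2) w) w := by
  obtain ⟨κ, hκ, hcross⟩ := exists_eventually_cross_eq_smul
    (complexify.continuous.continuousAt.comp hν_cont) (hasFDerivAt_complexTangent hX).continuousAt
    (complexTangent_ne_zero hconf.self_of_nhds)
    (by filter_upwards [hconf, hν] with w hw hνw using exists_cross_complexTangent_eq_smul hw hνw)
  refine ⟨-κ, by rw [neg_sq, hκ], ?_⟩
  filter_upwards [hcross, hp, eventually_hasFDerivAt hX] with w hw hpw hXw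
  have hgrad (k : Fin 3) := hasGradientAt_coord hXw.differentiableAt k
  have hvertical : -κ * ∇ (fun y => X y 2) w
      = ν w 1 • complexTangent X w 0 - ν w 0 • complexTangent X w 1 := by
    have h : (complexify (ν w) ⨯₃ complexTangent X w) 2 = κ * complexTangent X w 2 :=
      congrFun hw 2
    rw [(hgrad 2).gradient, neg_mul, ← h, cross_apply]
    simp [complexify]
  rw [hasGradientAt_iff_hasFDerivAt, hvertical, map_sub, map_smul, map_smul]
  rwa [(hgrad 0).hasFDerivAt.fderiv, (hgrad 1).hasFDerivAt.fderiv] at hpw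

theorem not_isLocalMax_sub_log_add_of_minimal (hX : ContDiffAt ℝ 2 X z)
    (hconf : ∀ᶠ w in 𝓝 z, ConformalAt X w) (hν : ∀ᶠ w in 𝓝 z, IsUnitNormal X w (ν w))
    (hν_cont : ContinuousAt ν z) (hmin : ∀ᶠ w in 𝓝 z, meanCurvature X w (ν w) = 0)
    (hp : ∀ᶠ w in 𝓝 z, HasFDerivAt p (ν w 1 • fderiv ℝ (fun y => X y 0) w
      - ν w 0 • fderiv ℝ (fun y => X y 1) w) w)
    (hg : HarmonicAt g z) (hpos : 0 < X z 0 ^ 2 + X z 1 ^ 2 - p z ^ 2)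
    {δ η : ℝ} (hδ : 0 ≤ δ) (hη : 0 < η) :
    ¬ IsLocalMax (fun w => g w - δ * Real.log (X w 0 ^ 2 + X w 1 ^ 2 - p w ^ 2)
      + η * (X w 0 ^ 2 + X w 1 ^ 2)) z := by
  have hX_diff := hX.differentiableAt two_ne_zero
  have hcoord (k : Fin 3) : HarmonicAt (fun w => X w k) z :=
    (harmonicAt_of_meanCurvature_eq_zero hX hconf hν hmin).comp_CLM (EuclideanSpace.proj k)
  obtain ⟨κ, hκ, hgrad⟩ := exists_hasGradientAt_mul hX hconf hν hν_cont hp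
  have hnull : ∇ (fun w => X w 0) z ^ 2 + ∇ (fun w => X w 1) z ^ 2 = ∇ p z ^ 2 := by
    rw [hgrad.self_of_nhds.gradient, mul_pow, hκ]
    linear_combination sum_gradient_sq_eq_zero hX_diff hconf.self_of_nhds
  exact not_isLocalMax_sub_log_add hg (hcoord 0) (hcoord 1)
    (harmonicAt_of_hasGradientAt_mul (hcoord 2).1 hκ hgrad) hnull
    (gradient_horizontal_ne_zero hX_diff hconf.self_of_nhds) hpos hδ hη

end Minimal

section MaximumPrinciple

theorem isCompact_setOf_nonneg_of_tendsto_atBot {S : Type*} [TopologicalSpace S] {u : S → ℝ}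
    (hu : Continuous u) (hlim : Tendsto u (cocompact S) atBot) : IsCompact {p | 0 ≤ u p} := by
  obtain ⟨K, hK, hKsub⟩ := mem_cocompact.mp (hlim.eventually_lt_atBot 0)
  refine hK.of_isClosed_subset (isClosed_le continuous_const hu) fun p hp => ?_
  by_contra hpK
  exact (show u p < 0 from hKsub hpK).not_ge hp

variable {M : Type*} [TopologicalSpace M] {U : Set M} {f k u ρ : M → ℝ}

theorem exists_isLocalMax_add_mul (hU : IsOpen U) (hu : ContinuousOn u (closure U))
    (hρ : ContinuousOn ρ (closure U)) (hρ₀ : ∀ p ∈ closure U, 0 ≤ ρ p)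
    (hcompact : IsCompact {p ∈ closure U | 0 ≤ u p}) (hfrontier : ∀ p ∈ frontier U, u p ≤ 0)
    {p₁ : M} (hp₁ : p₁ ∈ closure U) (hpos : 0 < u p₁) :
    ∃ η > 0, ∃ p ∈ U, IsLocalMax (fun p => u p + η * ρ p) p := by
  obtain ⟨R, hR⟩ := hcompact.bddAbove_image (hρ.mono (Set.sep_subset _ _))
  obtain ⟨η, hη, hηR⟩ := exists_pos_mul_lt hpos R
  obtain ⟨p, ⟨hp, hup⟩, hmax⟩ := hcompact.exists_isMaxOn ⟨p₁, hp₁, hpos.le⟩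
    ((hu.add (hρ.const_mul η)).mono (Set.sep_subset _ _))
  have hup_pos : 0 < u p := by
    have h₁ : u p₁ + η * ρ p₁ ≤ u p + η * ρ p := hmax ⟨hp₁, hpos.le⟩
    have h₂ : η * ρ p ≤ η * R := mul_le_mul_of_nonneg_left (hR ⟨p, ⟨hp, hup⟩, rfl⟩) hη.le
    have h₃ : 0 ≤ η * ρ p₁ := mul_nonneg hη.le (hρ₀ p₁ hp₁)
    linarith
  have hpU : p ∈ U := by
    by_contra hpU
    exact hup_pos.not_ge (hfrontier p (hU.frontier_eq ▸ ⟨hp, hpU⟩))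
  refine ⟨η, hη, p, hpU, ?_⟩
  have hnhds : closure U ∈ 𝓝 p := mem_of_superset (hU.mem_nhds hpU) subset_closure
  filter_upwards [hnhds, (hu.continuousAt hnhds).eventually_const_lt hup_pos] with w hw huw
  exact hmax ⟨hw, huw.le⟩

theorem isCompact_setOf_nonneg_sub_mul {B δ : ℝ} (hδ : 0 < δ) (hf : ContinuousOn f (closure U))
    (hk : ContinuousOn k (closure U)) (hB : ∀ p ∈ closure U, f p ≤ B)
    (hk_tendsto : Tendsto ((closure U).domRestrict k) (cocompact (closure U)) atTop) :
    IsCompact {p ∈ closure U | 0 ≤ f p - δ * k p} := by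
  have hlim : Tendsto ((closure U).domRestrict fun p => f p + -(δ * k p)) (cocompact _) atBot :=
    tendsto_atBot_add_left_of_ge _ B (fun p => hB p p.2) <|
      tendsto_neg_atTop_atBot.comp (hk_tendsto.const_mul_atTop hδ)
  have hcont : ContinuousOn (fun p => f p + -(δ * k p)) (closure U) :=
    hf.add (hk.const_mul δ).neg
  have h := (isCompact_setOf_nonneg_of_tendsto_atBot
    (continuousOn_iff_continuous_domRestrict.mp hcont) hlim).image continuous_subtype_val
  convert h using 1
  exact (Subtype.image_preimage_coe (closure U) {p | 0 ≤ f p - δ * k p}).symm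

theorem nonpos_of_forall_not_isLocalMax (hU : IsOpen U) (hf : ContinuousOn f (closure U))
    (hk : ContinuousOn k (closure U)) (hρ : ContinuousOn ρ (closure U))
    (hρ₀ : ∀ p ∈ closure U, 0 ≤ ρ p) {B : ℝ} (hB : ∀ p ∈ closure U, f p ≤ B)
    (hk_tendsto : Tendsto ((closure U).domRestrict k) (cocompact (closure U)) atTop)
    (hmax : ∀ δ > 0, ∀ η > 0, ∀ p ∈ U, ¬ IsLocalMax (fun p => f p - δ * k p + η * ρ p) p)
    (hfrontier : ∀ p ∈ frontier U, f p ≤ 0) : ∀ p ∈ closure U, f p ≤ 0 := by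
  by_contra! h
  obtain ⟨p₁, hp₁, hpos⟩ := h
  have : Nonempty (closure U) := ⟨⟨p₁, hp₁⟩⟩
  obtain ⟨p₀, hp₀⟩ := (continuousOn_iff_continuous_domRestrict.mp hk).exists_forall_le hk_tendsto
  obtain ⟨δ, hδ, hδ_lt⟩ := exists_pos_mul_lt hpos (k p₁ - k p₀)
  have hk_sub : ContinuousOn (fun p => k p - k p₀) (closure U) := hk.sub continuousOn_const
  have hcompact := isCompact_setOf_nonneg_sub_mul hδ hf hk_sub hB
    (tendsto_atTop_add_const_right _ (-k p₀) hk_tendsto)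
  have hu_frontier (p : M) (hp : p ∈ frontier U) : f p - δ * (k p - k p₀) ≤ 0 := by
    have hk₀ : k p₀ ≤ k p := hp₀ ⟨p, frontier_subset_closure hp⟩
    have := mul_nonneg hδ.le (sub_nonneg.mpr hk₀)
    linarith [hfrontier p hp]
  have hu_cont : ContinuousOn (fun p => f p - δ * (k p - k p₀)) (closure U) :=
    hf.sub (hk_sub.const_mul δ)
  obtain ⟨η, hη, p, hp, hloc⟩ := exists_isLocalMax_add_mul hU hu_cont hρ hρ₀ hcompact hu_frontier
    hp₁ (by linarith)
  refine hmax δ hδ η hη p hp ?_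
  refine (hloc.add (isLocalMax_const (b := -(δ * k p₀)))).congr (.of_forall fun w => ?_)
  ring

end MaximumPrinciple

section GrowthBound

variable {M : Type*} {Y : M → E3} {Q : M → ℝ} {p : M} {ε : ℝ}

/-- The square `Y₁² + Y₂² - Q²` of `(Y₁, Y₂, Q)` in Lorentz-Minkowski space, where `Q` is the time
coordinate. -/
def lorentzSq (Y : M → E3) (Q : M → ℝ) (p : M) : ℝ := ‖horizontalProj (Y p)‖ ^ 2 - Q p ^ 2

theorem norm_horizontalProj_sq (x : E3) : ‖horizontalProj x‖ ^ 2 = x 0 ^ 2 + x 1 ^ 2 := by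
  simp [EuclideanSpace.norm_sq_eq, horizontalProj, Fin.sum_univ_two]

theorem two_mul_sub_sq_le_lorentzSq (hbound : |Q p| ≤ ‖horizontalProj (Y p)‖ - ε) :
    2 * ε * ‖horizontalProj (Y p)‖ - ε ^ 2 ≤ lorentzSq Y Q p := by
  have hsq : Q p ^ 2 ≤ (‖horizontalProj (Y p)‖ - ε) ^ 2 :=
    sq_le_sq' (neg_le_of_abs_le hbound) (le_of_abs_le hbound)
  rw [lorentzSq]
  linarith

theorem lorentzSq_pos (hε : 0 < ε) (hbound : |Q p| ≤ ‖horizontalProj (Y p)‖ - ε) :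
    0 < lorentzSq Y Q p :=
  sub_pos.mpr (sq_lt_sq.mpr (hbound.trans_lt ((sub_lt_self _ hε).trans_le (le_abs_self _))))

theorem tendsto_log_lorentzSq [TopologicalSpace M] {U : Set M} (hε : 0 < ε)
    (hproper : IsProperMap fun p : closure U => horizontalProj (Y p))
    (hbound : ∀ p ∈ closure U, |Q p| ≤ ‖horizontalProj (Y p)‖ - ε) :
    Tendsto ((closure U).domRestrict fun p => Real.log (lorentzSq Y Q p))
      (cocompact (closure U)) atTop := by
  have hnorm : Tendsto (fun p : closure U => ‖horizontalProj (Y p)‖) (cocompact _) atTop :=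
    tendsto_norm_cocompact_atTop.comp (isProperMap_iff_tendsto_cocompact.mp hproper).2
  refine Real.tendsto_log_atTop.comp (tendsto_atTop_mono
    (fun p : closure U => two_mul_sub_sq_le_lorentzSq (hbound p p.2)) ?_)
  exact tendsto_atTop_add_const_right _ _ (hnorm.const_mul_atTop (by positivity))

end GrowthBound

theorem eventually_chart_symm {M : Type*} [TopologicalSpace M] {U : Set M} {p : M}
    {e : OpenPartialHomeomorph M ℂ} {Pr : M → ℂ → Prop} (hU : IsOpen U) (hp : p ∈ e.source ∩ U)
    (h : ∀ q ∈ e.source ∩ U, Pr q (e q)) :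
    ∀ᶠ w in 𝓝 (e p), Pr (e.symm w) w := by
  have hnhds : e.target ∩ e.symm ⁻¹' U ∈ 𝓝 (e p) :=
    (e.isOpen_inter_preimage_symm hU).mem_nhds
      ⟨e.map_source hp.1, by simpa only [Set.mem_preimage, e.left_inv hp.1] using hp.2⟩
  filter_upwards [hnhds] with w hw
  simpa only [e.right_inv hw.1] using h _ ⟨e.map_target hw.1, hw.2⟩

section Surface

variable {M : Type*} [TopologicalSpace M] [ChartedSpace ℂ M] {U : Set M} {Y N : M → E3}
  {P Q f : M → ℝ} {p : M}

theorem IsPrimitivePsi.add_const (hP : IsPrimitivePsi U Y N P) (c : ℝ) :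
    IsPrimitivePsi U Y N (fun p => P p + c) :=
  ⟨hP.continuousOn.add continuousOn_const, fun e he p hp => (hP.hasFDerivAt e he p hp).add_const c⟩

theorem IsConformalMinimalImmersion.contDiffAt (hY : IsConformalMinimalImmersion U Y)
    (hU : IsOpen U) {e : OpenPartialHomeomorph M ℂ} (he : e ∈ atlas ℂ M) (hp : p ∈ e.source ∩ U) :
    ContDiffAt ℝ 2 (Y ∘ e.symm) (e p) := by
  have hmem : e p ∈ e.target ∩ e.symm ⁻¹' U :=
    ⟨e.map_source hp.1, by simpa only [Set.mem_preimage, e.left_inv hp.1] using hp.2⟩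
  exact ((hY.smooth e he).contDiffAt ((e.isOpen_inter_preimage_symm hU).mem_nhds hmem)).of_le
    (by norm_cast)

theorem not_isLocalMax_sub_log_lorentzSq_add (hU : IsOpen U)
    (hY : IsConformalMinimalImmersion U Y) (hN : IsGaussMap U Y N) (hQ : IsPrimitivePsi U Y N Q)
    (hf : IsHarmonicOn f U) (hp : p ∈ U) (hpos : 0 < lorentzSq Y Q p) {δ η : ℝ} (hδ : 0 ≤ δ)
    (hη : 0 < η) :
    ¬ IsLocalMax (fun p => f p - δ * Real.log (lorentzSq Y Q p)
      + η * ‖horizontalProj (Y p)‖ ^ 2) p := by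
  intro hmax
  set e := chartAt ℂ p
  have he : e ∈ atlas ℂ M := chart_mem_atlas ℂ p
  have hp' : p ∈ e.source ∩ U := ⟨mem_chart_source ℂ p, hp⟩
  have hcont : ContinuousAt e.symm (e p) := e.continuousAt_symm (e.map_source hp'.1)
  have hsymm : e.symm (e p) = p := e.left_inv hp'.1
  have hN_cont : ContinuousAt (N ∘ e.symm) (e p) :=
    ContinuousAt.comp (hsymm.symm ▸ hN.continuousOn.continuousAt (hU.mem_nhds hp)) hcont
  have hQ_deriv := eventually_chart_symm
    (Pr := fun q w => HasFDerivAt (Q ∘ e.symm) (N q 1 • fderiv ℝ (fun z => Y (e.symm z) 0) w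
      - N q 0 • fderiv ℝ (fun z => Y (e.symm z) 1) w) w) hU hp' (hQ.hasFDerivAt e he)
  simp only [lorentzSq, norm_horizontalProj_sq] at hmax hpos
  rw [← hsymm] at hmax hpos
  refine not_isLocalMax_sub_log_add_of_minimal (hY.contDiffAt hU he hp')
    (eventually_chart_symm hU hp' (hY.conformal e he))
    (eventually_chart_symm (Pr := fun q w => IsUnitNormal (Y ∘ e.symm) w (N q)) hU hp'
      (hN.unitNormal e he))
    hN_cont
    (eventually_chart_symm (Pr := fun q w => meanCurvature (Y ∘ e.symm) w (N q) = 0) hU hp'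
      fun q hq => hY.minimal e he q hq _ (hN.unitNormal e he q hq))
    hQ_deriv (hf e he p hp') hpos hδ hη
    (hmax.comp_tendsto hcont)

theorem nonpos_of_nonpos_on_frontier (hU : IsOpen U) (hY : IsConformalMinimalImmersion U Y)
    (hproper : IsProperMap fun p : closure U => horizontalProj (Y p)) (hN : IsGaussMap U Y N)
    (hQ : IsPrimitivePsi U Y N Q) {ε : ℝ} (hε : 0 < ε)
    (hbound : ∀ p ∈ closure U, |Q p| ≤ ‖horizontalProj (Y p)‖ - ε)
    (hf_cont : ContinuousOn f (closure U)) {B : ℝ} (hB : ∀ p ∈ closure U, f p ≤ B)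
    (hf : IsHarmonicOn f U) (hfrontier : ∀ p ∈ frontier U, f p ≤ 0) :
    ∀ p ∈ closure U, f p ≤ 0 := by
  have hpos (p : M) (hp : p ∈ closure U) : 0 < lorentzSq Y Q p := lorentzSq_pos hε (hbound p hp)
  have hr : ContinuousOn (fun p => ‖horizontalProj (Y p)‖ ^ 2) (closure U) :=
    (continuousOn_iff_continuous_domRestrict.mpr hproper.continuous).norm.pow 2
  have hlog : ContinuousOn (fun p => Real.log (lorentzSq Y Q p)) (closure U) :=
    (hr.sub (hQ.continuousOn.pow 2)).log fun p hp => (hpos p hp).ne'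
  exact nonpos_of_forall_not_isLocalMax hU hf_cont hlog hr (fun p _ => sq_nonneg _) hB
    (tendsto_log_lorentzSq hε hproper hbound)
    (fun δ hδ η hη p hp => not_isLocalMax_sub_log_lorentzSq_add hU hY hN hQ hf hp
      (hpos p (subset_closure hp)) hδ.le hη) hfrontier

end Surface

end BorderedSurface

end

theorem mainTheorem6_general {M : Type*} [TopologicalSpace M] [ChartedSpace ℂ M] {U : Set M}
    (hU : IsOpen U) {Y N : M → BorderedSurface.E3} {Q : M → ℝ} {ε : ℝ}
    (hY : BorderedSurface.IsConformalMinimalImmersion U Y)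
    (hproper : IsProperMap (fun p : closure U => BorderedSurface.horizontalProj (Y p)))
    (hN : BorderedSurface.IsGaussMap U Y N) (hQ : BorderedSurface.IsPrimitivePsi U Y N Q)
    (hε : 0 < ε) (hbound : ∀ p ∈ closure U, |Q p| ≤ ‖BorderedSurface.horizontalProj (Y p)‖ - ε) :
    BorderedSurface.IsRelativeParabolic U := by
  intro f hf_cont ⟨B, hB⟩ hf hfrontier p hp
  refine le_antisymm ?upper (neg_nonpos.mp ?lower)
  case upper =>
    exact BorderedSurface.nonpos_of_nonpos_on_frontier hU hY hproper hN hQ hε hbound hf_cont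
      (fun q hq => le_of_abs_le (hB q hq)) hf (fun q hq => (hfrontier q hq).le) p hp
  case lower =>
    exact BorderedSurface.nonpos_of_nonpos_on_frontier hU hY hproper hN hQ hε hbound hf_cont.neg
      (fun q hq => neg_le.mp (neg_le_of_abs_le (hB q hq))) (fun e he q hq => (hf e he q hq).neg)
      (fun q hq => by simp [hfrontier q hq]) p hp

theorem mainTheorem6 {M : Type*} [TopologicalSpace M] [T2Space M] [ChartedSpace ℂ M]
    [IsManifold 𝓘(ℂ) ω M]
    (U : Set M) (hUo : IsOpen U) (hUc : IsConnected U) (hbd : (frontier U).Nonempty)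
    (Y : M → BorderedSurface.E3) (hY : BorderedSurface.IsConformalMinimalImmersion U Y)
    (hproper : IsProperMap (fun p : closure U => BorderedSurface.horizontalProj (Y p)))
    (N : M → BorderedSurface.E3) (hN : BorderedSurface.IsGaussMap U Y N)
    (P : M → ℝ) (hP : BorderedSurface.IsPrimitivePsi U Y N P)
    (p₀ : M) (hp₀ : p₀ ∈ U) (ε : ℝ) (hε : 0 < ε) (C : ℝ)
    (hbound : ∀ p ∈ closure U,
      |(P p - P p₀) + C| ≤ ‖BorderedSurface.horizontalProj (Y p)‖ - ε) :
    BorderedSurface.IsRelativeParabolic U :=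
  mainTheorem6_general hUo hY hproper hN
    (by simpa only [sub_eq_add_neg, add_assoc] using hP.add_const (-P p₀ + C)) hε hbound
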